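/- Let $H=(H^{ij})_{i,j\in\{1,2\}}$ be a real matrix with $H^{ij}\ge 0$, $H^{12}>0$, $H^{21}>0$, and put $H_1=H^{11}+H^{21}$, $H_2=H^{12}+H^{22}$; assume $H_1\ne H_2$. Let $f:[0,1]\to[0,\infty)$ be continuous, non-decreasing and differentiable on $[0,1]$ (with finite one-sided derivatives at $0$ and $1$), with $f(0)=0$, $f(1)=1$ and $f>0$ on $(0,1]$. Let $Y_0=(Y^1_0,Y^2_0)\in\mathbb{N}^2\setminus\{0\}$ be deterministic, and let $X_1,X_2,\dots$ be random variables with values in $\{1,2\}$ on a probability space $(\Omega,\mathcal A,\mathbb P)$. For $n\ge 0$ and $i\in\{1,2\}$ define $$Y^i_{n+1}=Y^i_n+\sum_{j=1}^2H^{ij}\mathbf 1_{\{X_{n+1}=j\}},\qquad T_n=Y^1_n+Y^2_n,\qquad Z_n=\frac{Y^1_n}{T_n},$$ and suppose that, with $\mathcal F_n=\sigma(X_1,\dots,X_n)$, $$\mathbb P(X_{n+1}=i\mid\mathcal F_n)=\frac{f(Y^i_n/T_n)}{f(Y^1_n/T_n)+f(Y^2_n/T_n)}\quad\text{a.s. for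 all } n\ge 0,\ i\in\{1,2\}.$$ (Since $H^{ij}\ge 0$ and $T_0>0$, the urn is never empty.) Let $$h(y)=\frac{(H^{11}-yH_1)f(y)+(H^{12}-yH_2)f(1-y)}{f(y)+f(1-y)},\qquad y\in[0,1].$$ Assume that $h$ is non-increasing on $[0,1]$ and that, if $\frac{H^{11}}{H_1}>\frac{H^{12}}{H_2}$, then $f$ is concave on $[0,1]$. Then $h$ has a unique zero $y^*$ in $[0,1]$, and for every $\varepsilon>0$ there is a constant $a>0$, independent of $n$, such that for all sufficiently large $n$ $$\mathbb P\big(|Z_{n+1}-y^*|>\varepsilon\big)\le 2e^{-an}.$$ -/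

import Mathlib

open Set Filter MeasureTheory ProbabilityTheory

noncomputable section

/-- Admissible skewing functions `f : [0,1] → ℝ⁺`, represented by a real function of which only the
values on `[0,1]` matter. Differentiability on the closed interval `[0,1]` includes finite
one-sided derivatives at the two end points. -/
structure IsSkewing (f : ℝ → ℝ) : Prop where
  continuousOn : ContinuousOn f (Icc 0 1)
  monotoneOn : MonotoneOn f (Icc 0 1)
  differentiableOn : DifferentiableOn ℝ f (Icc 0 1)
  map_zero : f 0 = 0
  map_one : f 1 = 1
  pos : ∀ y ∈ Ioc (0 : ℝ) 1, 0 < f y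

/-- The total number of balls added when a ball of type `j` is drawn: the sum of the `j`-th column
of the replacement matrix. (Types 1 and 2 are the indices `0` and `1`.) -/
def colTotal (H : Matrix (Fin 2) (Fin 2) ℝ) (j : Fin 2) : ℝ := ∑ i, H i j

/-- The conditions on the replacement matrix: non-negative entries, unbalanced, and strictly
positive off-diagonal entries. (With non-negative entries and a non-empty initial urn, the urn
is never empty, so that tenability is automatic.) -/
structure IsUnbalancedReplacement (H : Matrix (Fin 2) (Fin 2) ℝ) : Prop where
  nonneg : ∀ i j, 0 ≤ H i j
  unbalanced : colTotal H 0 ≠ colTotal H 1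
  pos_zero_one : 0 < H 0 1
  pos_one_zero : 0 < H 1 0

/-- The drift function `h` of the urn, for arguments in `[0,1]`. -/
def drift (f : ℝ → ℝ) (H : Matrix (Fin 2) (Fin 2) ℝ) (y : ℝ) : ℝ :=
  ((H 0 0 - y * colTotal H 0) * f y + (H 0 1 - y * colTotal H 1) * f (1 - y)) /
    (f y + f (1 - y))

section Urn

variable {Ω : Type*}

/-- The composition `(Y¹ₙ, Y²ₙ)` of the urn after `n` draws, when the `n`-th draw (`n ≥ 1`)
produces a ball of type `X n`; the value `X 0` plays no role. -/
def composition (H : Matrix (Fin 2) (Fin 2) ℝ) (y₀ : Fin 2 → ℕ) (X : ℕ → Ω → Fin 2) :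
    ℕ → Ω → Fin 2 → ℝ
  | 0 => fun _ i => (y₀ i : ℝ)
  | n + 1 => fun ω i => composition H y₀ X n ω i + H i (X (n + 1) ω)

/-- The total number of balls `Tₙ`. -/
def total (H : Matrix (Fin 2) (Fin 2) ℝ) (y₀ : Fin 2 → ℕ) (X : ℕ → Ω → Fin 2)
    (n : ℕ) (ω : Ω) : ℝ :=
  ∑ i, composition H y₀ X n ω i

/-- The proportion `Yⁱₙ / Tₙ` of balls of type `i`; `Zₙ` is the case `i = 0`. -/
def proportion (H : Matrix (Fin 2) (Fin 2) ℝ) (y₀ : Fin 2 → ℕ) (X : ℕ → Ω → Fin 2)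
    (i : Fin 2) (n : ℕ) (ω : Ω) : ℝ :=
  composition H y₀ X n ω i / total H y₀ X n ω

/-- The σ-algebra generated by the first `n` draws `X 1, …, X n`. -/
abbrev drawSigma (X : ℕ → Ω → Fin 2) (n : ℕ) : MeasurableSpace Ω :=
  ⨆ k ∈ Set.Icc 1 n, MeasurableSpace.comap (X k) ⊤

/-- `X 1, X 2, …` are the draws of the nonlinear urn with skewing function `f`, replacement
matrix `H` and initial composition `y₀`: given the first `n` draws, a ball of type `i` is drawn
with probability `f(Yⁱₙ/Tₙ) / (f(Y¹ₙ/Tₙ) + f(Y²ₙ/Tₙ))`. -/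
structure IsUrnDraws [MeasurableSpace Ω] (P : Measure Ω) (f : ℝ → ℝ)
    (H : Matrix (Fin 2) (Fin 2) ℝ) (y₀ : Fin 2 → ℕ) (X : ℕ → Ω → Fin 2) : Prop where
  measurable : ∀ n, 1 ≤ n → Measurable (X n)
  condProb : ∀ (n : ℕ) (i : Fin 2),
    P⟦{ω | X (n + 1) ω = i} | drawSigma X n⟧ =ᵐ[P] fun ω =>
      f (proportion H y₀ X i n ω) /
        (f (proportion H y₀ X 0 n ω) + f (proportion H y₀ X 1 n ω))

end Urn

end

/-! Existence of the zero is the intermediate value theorem, since `h 0 > 0 > h 1`; uniqueness is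
`not_lt_of_drift_eq_zero`. Monotonicity of `h` then bounds it away from zero, with the right sign,
at distance at least `ε / 2` from `y*`.

For the tail, the function `L = T (e ^ (κ Z) - e ^ θ)` is followed along the urn. It is homogeneous
of degree one in the composition, so its steps are bounded even though the number of balls added is
random. If `s` is the mean number of balls added, the mean step is `e ^ (κ Z) (s + κ h(Z)) - s e ^ θ
+ O(1 / T)`. Where `H₁ + H₂ + κ h ≤ 0` the bracket is nonpositive, leaving a strictly negative mean
once `T` is large. Where `κ Z < θ`, `L` is negative, so its next value is bounded above. Hence for
small `l > 0` the moment `E e ^ (l L)` grows at most linearly in `n` (`exists_exp_lyap_step`,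
`integral_exp_lyap_succ_le`).

On `{κ Z ≥ θ + η}`, `L` is at least a positive multiple of `n`, because `T` grows at least linearly;
Markov's inequality gives exponential decay (`exists_exp_tail`). A large positive `κ` handles the
upper tail, a large negative one the lower tail. -/

/-! ### Elementary bounds on `H` and `f` -/

namespace IsUnbalancedReplacement

variable {H : Matrix (Fin 2) (Fin 2) ℝ}

lemma colTotal_pos (hH : IsUnbalancedReplacement H) (j : Fin 2) : 0 < colTotal H j := by
  have h00 := hH.nonneg 0 0
  have h11 := hH.nonneg 1 1
  have h01 := hH.pos_zero_one
  have h10 := hH.pos_one_zero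
  fin_cases j <;> simp [colTotal] <;> linarith

lemma le_colTotal (hH : IsUnbalancedReplacement H) (i j : Fin 2) : H i j ≤ colTotal H j :=
  Finset.single_le_sum (f := fun i => H i j) (fun i _ => hH.nonneg i j) (Finset.mem_univ i)

lemma colTotal_le (hH : IsUnbalancedReplacement H) (j : Fin 2) :
    colTotal H j ≤ colTotal H 0 + colTotal H 1 := by
  have h0 := hH.colTotal_pos 0
  have h1 := hH.colTotal_pos 1
  fin_cases j <;> simp <;> linarith

end IsUnbalancedReplacement

namespace IsSkewing

variable {f : ℝ → ℝ}

lemma nonneg (hf : IsSkewing f) {y : ℝ} (hy : y ∈ Icc (0 : ℝ) 1) : 0 ≤ f y := by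
  rcases hy.1.eq_or_lt with h | h
  · rw [← h, hf.map_zero]
  · exact (hf.pos y ⟨h, hy.2⟩).le

lemma add_pos (hf : IsSkewing f) {y : ℝ} (hy : y ∈ Icc (0 : ℝ) 1) : 0 < f y + f (1 - y) := by
  have h1 : 1 - y ∈ Icc (0 : ℝ) 1 := ⟨by linarith [hy.2], by linarith [hy.1]⟩
  rcases hy.1.eq_or_lt with h | h
  · have := hf.pos (1 - y) ⟨by linarith, h1.2⟩
    linarith [hf.nonneg hy]
  · have := hf.pos y ⟨h, hy.2⟩
    linarith [hf.nonneg h1]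

end IsSkewing

/-! ### The unique zero of the drift -/

section Zero

variable {f : ℝ → ℝ} {H : Matrix (Fin 2) (Fin 2) ℝ}

lemma drift_zero (hf : IsSkewing f) : drift f H 0 = H 0 1 := by
  simp [drift, hf.map_zero, hf.map_one]

lemma drift_one (hf : IsSkewing f) : drift f H 1 = - H 1 0 := by
  simp [drift, hf.map_zero, hf.map_one, colTotal]

lemma continuousOn_drift (hf : IsSkewing f) : ContinuousOn (drift f H) (Icc 0 1) := by
  have hr : ContinuousOn (fun y => f (1 - y)) (Icc 0 1) :=
    hf.continuousOn.comp (by fun_prop) fun y hy => ⟨by linarith [hy.2], by linarith [hy.1]⟩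
  have hc := hf.continuousOn
  unfold drift
  refine ContinuousOn.div ?_ (hc.add hr) fun y hy => (hf.add_pos hy).ne'
  exact ((by fun_prop : ContinuousOn (fun y => H 0 0 - y * colTotal H 0) (Icc 0 1)).mul hc).add
    ((by fun_prop : ContinuousOn (fun y => H 0 1 - y * colTotal H 1) (Icc 0 1)).mul hr)

lemma exists_drift_eq_zero (hf : IsSkewing f) (hH : IsUnbalancedReplacement H) :
    ∃ y ∈ Icc (0 : ℝ) 1, drift f H y = 0 := by
  have := intermediate_value_Icc' zero_le_one (continuousOn_drift (H := H) hf)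
  rw [drift_zero hf, drift_one hf] at this
  exact this ⟨by linarith [hH.pos_one_zero], hH.pos_zero_one.le⟩

/-- A drift function has at most one zero: either the share of added balls of the first type
decreases along the urn, or concavity makes `y ↦ f y / y` antitone. -/
lemma not_lt_of_drift_eq_zero (hf : IsSkewing f) (hH : IsUnbalancedReplacement H)
    (hconc : H 0 0 / colTotal H 0 > H 0 1 / colTotal H 1 → ConcaveOn ℝ (Icc 0 1) f)
    {y z : ℝ} (hy : y ∈ Icc (0 : ℝ) 1) (hz : z ∈ Icc (0 : ℝ) 1)
    (hy0 : drift f H y = 0) (hz0 : drift f H z = 0) : ¬ y < z := by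
  intro hyz
  -- Both zeros are interior, so `f` is positive at all four points used below.
  have ypos : 0 < y := by
    refine hy.1.lt_of_ne fun h => ?_
    rw [← h, drift_zero hf] at hy0
    exact hH.pos_zero_one.ne' hy0
  have zlt : z < 1 := by
    refine hz.2.lt_of_ne fun h => ?_
    rw [h, drift_one hf] at hz0
    linarith [hH.pos_one_zero]
  have e1 := (div_eq_zero_iff.1 hy0).resolve_right (hf.add_pos hy).ne'
  have e2 := (div_eq_zero_iff.1 hz0).resolve_right (hf.add_pos hz).ne'
  have hy' : 1 - y ∈ Icc (0 : ℝ) 1 := ⟨by linarith, by linarith⟩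
  have hz' : 1 - z ∈ Icc (0 : ℝ) 1 := ⟨by linarith, by linarith⟩
  have hA := hf.pos y ⟨ypos, hy.2⟩
  have hB := hf.pos (1 - y) ⟨by linarith, hy'.2⟩
  have hA' := hf.pos z ⟨by linarith, hz.2⟩
  have hB' := hf.pos (1 - z) ⟨by linarith, hz'.2⟩
  have hAA := hf.monotoneOn hy hz hyz.le
  have hBB := hf.monotoneOn hz' hy' (by linarith)
  have c0 := hH.colTotal_pos 0
  have c1 := hH.colTotal_pos 1
  have e0 : colTotal H 0 = H 0 0 + H 1 0 := by simp [colTotal]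
  have e0' : colTotal H 1 = H 0 1 + H 1 1 := by simp [colTotal]
  have hcc : H 0 1 / colTotal H 1 < H 0 0 / colTotal H 0 ↔
      H 0 1 * colTotal H 0 < H 0 0 * colTotal H 1 := div_lt_div_iff₀ c1 c0
  by_cases hcase : H 0 1 / colTotal H 1 < H 0 0 / colTotal H 0
  · have hf' := hconc hcase
    rw [hcc] at hcase
    -- Concavity together with `f 0 = 0`: slopes from the origin decrease.
    have ray : ∀ {s t : ℝ}, 0 < s → s < t → t ≤ 1 → f t * s ≤ f s * t := by
      intro s t hs hst ht
      have hst' : 0 ≤ 1 - s / t := by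
        rw [sub_nonneg, div_le_one (by linarith)]
        exact hst.le
      have := hf'.2 (⟨le_rfl, zero_le_one⟩ : (0 : ℝ) ∈ Icc (0 : ℝ) 1)
        (⟨by linarith, ht⟩ : t ∈ Icc (0 : ℝ) 1) hst'
        (div_nonneg hs.le (by linarith) : 0 ≤ s / t) (by ring)
      have ht0 : t ≠ 0 := by linarith
      simp only [smul_eq_mul, mul_zero, zero_add, hf.map_zero, div_mul_cancel₀ s ht0] at this
      rw [div_mul_eq_mul_div, div_le_iff₀ (by linarith)] at this
      linarith
    have r1 := ray ypos hyz hz.2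
    have r2 := ray (s := 1 - z) (t := 1 - y) (by linarith) (by linarith) (by linarith)
    set A := f y
    set B := f (1 - y)
    set A' := f z
    set B' := f (1 - z)
    -- A zero lies strictly between the two ratios `H 0 j / colTotal H j`: the two factors must
    -- balance, and `hcase` excludes the opposite signs.
    have sgn : ∀ {w a b : ℝ}, 0 < a → 0 < b →
        (H 0 0 - w * colTotal H 0) * a + (H 0 1 - w * colTotal H 1) * b = 0 →
        0 < H 0 0 - w * colTotal H 0 ∧ 0 < w * colTotal H 1 - H 0 1 := by
      intro w a b ha hb h
      have hu : 0 < H 0 0 - w * colTotal H 0 := by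
        by_contra! hu
        have hv : 0 < w * colTotal H 1 - H 0 1 := by
          by_contra! hv
          nlinarith
        nlinarith
      refine ⟨hu, ?_⟩
      by_contra! hv
      nlinarith [mul_pos hu ha]
    obtain ⟨hu, hv⟩ := sgn hA hB e1
    obtain ⟨hu', hv'⟩ := sgn hA' hB' e2
    -- Divide the zero equation `u A = v B` by `y (1 - y)`. In `u / (1 - y) * (A / y)` the first
    -- factor strictly decreases with `y`; in `v / y * (B / (1 - y))` the first factor strictly
    -- increases. By `ray` the other factors move in the same directions weakly, so equality cannot
    -- hold twice.
    have k1 : (H 0 0 - z * colTotal H 0) * (1 - y) < (H 0 0 - y * colTotal H 0) * (1 - z) := by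
      rw [e0]; nlinarith [mul_pos hH.pos_one_zero (sub_pos.2 hyz)]
    have k2 : (y * colTotal H 1 - H 0 1) * z < (z * colTotal H 1 - H 0 1) * y := by
      nlinarith [mul_pos hH.pos_zero_one (sub_pos.2 hyz)]
    set u := H 0 0 - y * colTotal H 0
    set v := y * colTotal H 1 - H 0 1
    set u' := H 0 0 - z * colTotal H 0
    set v' := z * colTotal H 1 - H 0 1
    have q1 : u * A = v * B := by simp only [u, v]; linarith
    have q2 : u' * A' = v' * B' := by simp only [u', v']; linarith
    have s1 : (u' * (1 - y)) * (A' * y) < (u * (1 - z)) * (A * z) :=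
      mul_lt_mul k1 r1 (by positivity) (by nlinarith)
    have s2 : (v * z) * (B * (1 - z)) < (v' * y) * (B' * (1 - y)) :=
      mul_lt_mul k2 r2 (mul_pos hB (by linarith)) (by positivity)
    have s3 : (u' * (1 - y)) * (A' * y) = (v' * y) * (B' * (1 - y)) := by
      linear_combination ((1 - y) * y) * q2
    have s4 : (u * (1 - z)) * (A * z) = (v * z) * (B * (1 - z)) := by
      linear_combination ((1 - z) * z) * q1
    linarith
  · rw [hcc, not_lt] at hcase
    set A := f y
    set B := f (1 - y)
    set A' := f z
    set B' := f (1 - z)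
    have cross : A * B' ≤ A' * B := mul_le_mul hAA hBB hB'.le hA'.le
    have d1 : 0 < colTotal H 0 * A + colTotal H 1 * B := by positivity
    have d2 : 0 < colTotal H 0 * A' + colTotal H 1 * B' := by positivity
    -- A zero is the average of the ratios `H 0 j / colTotal H j` with weights proportional to
    -- `colTotal H 0 * A` and `colTotal H 1 * B`. Moving right shifts weight to the ratio with `j =
    -- 0`, here the smaller or equal one, so the average cannot increase.
    have key : (z - y) * ((colTotal H 0 * A + colTotal H 1 * B) *
        (colTotal H 0 * A' + colTotal H 1 * B')) =
        (A' * B - A * B') * (H 0 0 * colTotal H 1 - H 0 1 * colTotal H 0) := by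
      linear_combination (colTotal H 0 * A' + colTotal H 1 * B') * e1 -
        (colTotal H 0 * A + colTotal H 1 * B) * e2
    have hpos := mul_pos (sub_pos.2 hyz) (mul_pos d1 d2)
    rw [key] at hpos
    nlinarith [mul_nonneg (sub_nonneg.2 cross) (sub_nonneg.2 hcase)]

end Zero

/-! ### Analytic estimates for the Lyapunov function -/

/-- The Lyapunov function `T (e ^ (κ Y / T) - c)` of an urn holding `T` balls in total, of which `Y`
are of the first type. -/
noncomputable def lyap (κ c T Y : ℝ) : ℝ := T * (Real.exp (κ * (Y / T)) - c)

lemma exp_mul_le_exp_abs {κ z : ℝ} (hz : z ∈ Icc (0 : ℝ) 1) :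
    Real.exp (κ * z) ≤ Real.exp |κ| := by
  refine Real.exp_le_exp.2 ?_
  nlinarith [le_abs_self κ, abs_nonneg κ, hz.1, hz.2]

lemma lyap_le {κ c T Y R : ℝ} (hc : 0 ≤ c) (hT : 0 < T) (hY : 0 ≤ Y) (hYT : Y ≤ T) (hR : T ≤ R) :
    lyap κ c T Y ≤ R * Real.exp |κ| := by
  have := exp_mul_le_exp_abs (κ := κ) (z := Y / T) ⟨by positivity, (div_le_one hT).2 hYT⟩
  unfold lyap
  exact mul_le_mul_of_nonneg hR (by linarith) hT.le (Real.exp_pos _).le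

lemma abs_sub_mul_le {z r s : ℝ} (hz : z ∈ Icc (0 : ℝ) 1) (hr : 0 ≤ r) (hrs : r ≤ s) :
    |r - z * s| ≤ s := by
  have h1 : 0 ≤ z * s := mul_nonneg hz.1 (hr.trans hrs)
  have h2 : z * s ≤ s := mul_le_of_le_one_left (hr.trans hrs) hz.2
  rw [abs_le]
  constructor <;> linarith

/-- First order expansion of the Lyapunov function when `s` balls are added, `r` of which are of
the first type. -/
lemma abs_lyap_add_sub_le {κ c K T z s r : ℝ} (hT : 0 < T) (hz : z ∈ Icc (0 : ℝ) 1)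
    (hr : 0 ≤ r) (hrs : r ≤ s) (hsK : s ≤ K) (hKT : |κ| * K ≤ T) :
    |lyap κ c (T + s) (z * T + r) - lyap κ c T (z * T) -
      (s * (Real.exp (κ * z) - c) + κ * Real.exp (κ * z) * (r - z * s))| ≤
      Real.exp |κ| * (κ ^ 2 * K ^ 2) / T := by
  have hs : 0 ≤ s := hr.trans hrs
  have hTs : 0 < T + s := by linarith
  -- `δ` is the change of the proportion. The expansion error is exactly the second-order remainder
  -- of `exp` at `κ δ`, times `T + s`; as `δ = O(1 / T)`, it is `O(1 / T)`.
  set δ := (r - z * s) / (T + s) with hδ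
  have hδ' : δ * (T + s) = r - z * s := div_mul_cancel₀ _ hTs.ne'
  have hrz : |r - z * s| ≤ K := (abs_sub_mul_le hz hr hrs).trans hsK
  have hz1 : z * T / T = z := by field_simp
  have hz2 : (z * T + r) / (T + s) = z + δ := by
    rw [div_eq_iff hTs.ne', add_mul, hδ']
    ring
  have hκδ : |κ * δ| ≤ 1 := by
    rw [abs_mul, hδ, abs_div, abs_of_pos hTs, ← mul_div_assoc, div_le_one hTs]
    calc |κ| * |r - z * s| ≤ |κ| * K := by gcongr
      _ ≤ T + s := by linarith
  have hexp := Real.abs_exp_sub_one_sub_id_le hκδ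
  have key : lyap κ c (T + s) (z * T + r) - lyap κ c T (z * T) -
      (s * (Real.exp (κ * z) - c) + κ * Real.exp (κ * z) * (r - z * s)) =
      (T + s) * Real.exp (κ * z) * (Real.exp (κ * δ) - 1 - κ * δ) := by
    rw [← hδ', lyap, lyap, hz1, hz2, mul_add κ z δ, Real.exp_add]
    ring
  rw [key, abs_mul, abs_of_pos (by positivity : 0 < (T + s) * Real.exp (κ * z))]
  calc (T + s) * Real.exp (κ * z) * |Real.exp (κ * δ) - 1 - κ * δ|
      ≤ (T + s) * Real.exp (κ * z) * (κ * δ) ^ 2 := by gcongr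
    _ = Real.exp (κ * z) * (κ ^ 2 * (r - z * s) ^ 2) / (T + s) := by
        rw [hδ]
        field_simp
    _ ≤ Real.exp |κ| * (κ ^ 2 * K ^ 2) / T := by
        have h1 := exp_mul_le_exp_abs (κ := κ) hz
        have h2 : (r - z * s) ^ 2 ≤ K ^ 2 := sq_le_sq' (abs_le.1 hrz).1 (abs_le.1 hrz).2
        gcongr
        linarith

lemma abs_lyap_add_sub_lyap_le {κ c K T z s r : ℝ} (hc : 0 ≤ c) (hT : 0 < T)
    (hz : z ∈ Icc (0 : ℝ) 1) (hr : 0 ≤ r) (hrs : r ≤ s) (hsK : s ≤ K) (hKT : |κ| * K ≤ T) :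
    |lyap κ c (T + s) (z * T + r) - lyap κ c T (z * T)| ≤
      K * (Real.exp |κ| + c) + |κ| * Real.exp |κ| * K +
        Real.exp |κ| * (κ ^ 2 * K ^ 2) / T := by
  have hs : 0 ≤ s := hr.trans hrs
  have he := exp_mul_le_exp_abs (κ := κ) hz
  have he0 := Real.exp_pos (κ * z)
  have h1 : |s * (Real.exp (κ * z) - c)| ≤ K * (Real.exp |κ| + c) := by
    rw [abs_mul, abs_of_nonneg hs]
    refine mul_le_mul hsK ?_ (abs_nonneg _) (hs.trans hsK)
    rw [abs_le]
    constructor <;> linarith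
  have h2 : |κ * Real.exp (κ * z) * (r - z * s)| ≤ |κ| * Real.exp |κ| * K := by
    rw [abs_mul, abs_mul, abs_of_pos he0]
    exact mul_le_mul (mul_le_mul_of_nonneg_left he (abs_nonneg κ))
      ((abs_sub_mul_le hz hr hrs).trans hsK) (abs_nonneg _) (by positivity)
  have h3 := abs_le.1 (abs_lyap_add_sub_le (κ := κ) (c := c) hT hz hr hrs hsK hKT)
  have h1' := abs_le.1 h1
  have h2' := abs_le.1 h2
  refine abs_le.2 ⟨?_, ?_⟩ <;> linarith [h1'.1, h1'.2, h2'.1, h2'.2, h3.1, h3.2]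

/-- One step of a two-valued random walk with bounded steps and negative mean does not increase
the exponential moment. -/
lemma weighted_exp_le {B d l p q x a b : ℝ} (hp : 0 ≤ p) (hq : 0 ≤ q) (hpq : p + q = 1)
    (hl : 0 ≤ l) (hlB : l * B ≤ 1) (hlB2 : l * B ^ 2 ≤ d) (ha : |a - x| ≤ B) (hb : |b - x| ≤ B)
    (hd : p * (a - x) + q * (b - x) ≤ -d) :
    p * Real.exp (l * a) + q * Real.exp (l * b) ≤ Real.exp (l * x) := by
  have step : ∀ {y : ℝ}, |y - x| ≤ B →
      Real.exp (l * y) ≤ Real.exp (l * x) * (1 + l * (y - x) + l ^ 2 * B ^ 2) := by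
    intro y hy
    have h1 : |l * (y - x)| ≤ 1 := by
      rw [abs_mul, abs_of_nonneg hl]
      exact (mul_le_mul_of_nonneg_left hy hl).trans hlB
    have h2 := (abs_le.1 (Real.abs_exp_sub_one_sub_id_le h1)).2
    have h3 : (y - x) ^ 2 ≤ B ^ 2 := sq_le_sq' (abs_le.1 hy).1 (abs_le.1 hy).2
    have h4 : (l * (y - x)) ^ 2 ≤ l ^ 2 * B ^ 2 := by
      rw [mul_pow]
      gcongr
    have h5 : l * y = l * x + l * (y - x) := by ring
    rw [h5, Real.exp_add]
    gcongr
    linarith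
  calc p * Real.exp (l * a) + q * Real.exp (l * b)
      ≤ p * (Real.exp (l * x) * (1 + l * (a - x) + l ^ 2 * B ^ 2)) +
        q * (Real.exp (l * x) * (1 + l * (b - x) + l ^ 2 * B ^ 2)) := by
        gcongr
        exacts [step ha, step hb]
    _ = Real.exp (l * x) * ((p + q) * (1 + l ^ 2 * B ^ 2) +
        l * (p * (a - x) + q * (b - x))) := by ring
    _ ≤ Real.exp (l * x) * 1 := by
        rw [hpq]
        refine mul_le_mul_of_nonneg_left ?_ (Real.exp_pos _).le
        -- The drift gain `l * d` pays for the second-order loss `l ^ 2 * B ^ 2`.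
        nlinarith [mul_le_mul_of_nonneg_left hd hl, mul_le_mul_of_nonneg_left hlB2 hl]
    _ = Real.exp (l * x) := mul_one _

/-- The total `s₀ + s₁` dominates the mean number of balls added, so `hκ` makes the part of the mean
proportional to `e` nonpositive. What remains is `-c` times a mean that is at least `μ`, plus the
error `d`. -/
lemma mean_step_le {p e c d κ μ z r₀ r₁ s₀ s₁ ξ₀ ξ₁ : ℝ} (hp : p ∈ Icc (0 : ℝ) 1) (he : 0 ≤ e)
    (hc : 0 ≤ c) (hs₀ : 0 ≤ s₀) (hs₁ : 0 ≤ s₁) (hμ₀ : μ ≤ s₀) (hμ₁ : μ ≤ s₁)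
    (hξ₀ : ξ₀ ≤ s₀ * (e - c) + κ * e * (r₀ - z * s₀) + d)
    (hξ₁ : ξ₁ ≤ s₁ * (e - c) + κ * e * (r₁ - z * s₁) + d)
    (hκ : s₀ + s₁ + κ * (p * (r₀ - z * s₀) + (1 - p) * (r₁ - z * s₁)) ≤ 0) :
    p * ξ₀ + (1 - p) * ξ₁ ≤ d - c * μ := by
  have hq : 0 ≤ 1 - p := sub_nonneg.2 hp.2
  have u0 := mul_le_mul_of_nonneg_left hξ₀ hp.1
  have u1 := mul_le_mul_of_nonneg_left hξ₁ hq
  have hm1 : p * s₀ + (1 - p) * s₁ ≤ s₀ + s₁ :=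
    add_le_add (mul_le_of_le_one_left hs₀ hp.2) (mul_le_of_le_one_left hs₁ (by linarith [hp.1]))
  have hm2 : μ ≤ p * s₀ + (1 - p) * s₁ := by
    linarith [mul_le_mul_of_nonneg_left hμ₀ hp.1, mul_le_mul_of_nonneg_left hμ₁ hq]
  have v1 := mul_le_mul_of_nonneg_left hκ he
  have v2 := mul_le_mul_of_nonneg_left hm1 he
  have v3 := mul_le_mul_of_nonneg_left hm2 hc
  linarith

/-! ### One-step bound for exponential moments -/

/-- The probability that a ball of the first type is drawn from an urn in which its proportion is
`z`. -/
noncomputable def drawProb (f : ℝ → ℝ) (z : ℝ) : ℝ := f z / (f z + f (1 - z))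

section Lyapunov

variable {f : ℝ → ℝ} {H : Matrix (Fin 2) (Fin 2) ℝ}

lemma IsSkewing.drawProb_mem (hf : IsSkewing f) {z : ℝ} (hz : z ∈ Icc (0 : ℝ) 1) :
    drawProb f z ∈ Icc (0 : ℝ) 1 := by
  have h1 : 0 ≤ f (1 - z) := hf.nonneg ⟨by linarith [hz.2], by linarith [hz.1]⟩
  exact ⟨div_nonneg (hf.nonneg hz) (hf.add_pos hz).le,
    (div_le_one (hf.add_pos hz)).2 (by linarith)⟩

lemma IsSkewing.one_sub_drawProb (hf : IsSkewing f) {z : ℝ} (hz : z ∈ Icc (0 : ℝ) 1) :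
    1 - drawProb f z = f (1 - z) / (f z + f (1 - z)) := by
  rw [drawProb, one_sub_div (hf.add_pos hz).ne', add_sub_cancel_left]

lemma IsSkewing.drift_eq (hf : IsSkewing f) {z : ℝ} (hz : z ∈ Icc (0 : ℝ) 1) :
    drift f H z = drawProb f z * (H 0 0 - z * colTotal H 0) +
      (1 - drawProb f z) * (H 0 1 - z * colTotal H 1) := by
  rw [hf.one_sub_drawProb hz, drawProb, drift]
  ring

/-- If `κ • drift` dominates the growth of the urn on `{z | θ ≤ κ z}`, the exponential moments of
the Lyapunov function grow by at most a bounded amount at each draw. -/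
lemma exists_exp_lyap_step (hf : IsSkewing f) (hH : IsUnbalancedReplacement H) {κ θ : ℝ}
    (hκ : ∀ z ∈ Icc (0 : ℝ) 1, θ ≤ κ * z →
      colTotal H 0 + colTotal H 1 + κ * drift f H z ≤ 0) :
    ∃ l C T₀ : ℝ, 0 < l ∧ 0 ≤ C ∧ ∀ T Y : ℝ, T₀ ≤ T → 0 ≤ Y → Y ≤ T →
      drawProb f (Y / T) *
        Real.exp (l * lyap κ (Real.exp θ) (T + colTotal H 0) (Y + H 0 0)) +
      (1 - drawProb f (Y / T)) *
        Real.exp (l * lyap κ (Real.exp θ) (T + colTotal H 1) (Y + H 0 1)) ≤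
      Real.exp (l * lyap κ (Real.exp θ) T Y) + C := by
  have c0 := hH.colTotal_pos 0
  have c1 := hH.colTotal_pos 1
  set K := colTotal H 0 + colTotal H 1 with hK
  set μ := min (colTotal H 0) (colTotal H 1) with hμ
  have μpos : 0 < μ := lt_min c0 c1
  set c := Real.exp θ with hc
  have cpos : 0 < c := Real.exp_pos θ
  set E := Real.exp |κ| with hE
  have Epos : 0 < E := Real.exp_pos _
  set Q := E * (κ ^ 2 * K ^ 2) with hQ
  have Qnn : 0 ≤ Q := by positivity
  -- Half of the negative drift `c * μ` is reserved for the expansion error `Q / T`, which is at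
  -- most `d` beyond the threshold chosen for `T`.
  set d := c * μ / 2 with hd
  have dpos : 0 < d := by positivity
  set B := K * (E + c) + |κ| * E * K + d with hB
  have Bpos : 0 < B := by positivity
  refine ⟨min (1 / B) (d / B ^ 2), Real.exp (min (1 / B) (d / B ^ 2) * B),
    |κ| * K + Q / d + 1, by positivity, by positivity, ?_⟩
  set l := min (1 / B) (d / B ^ 2) with hl
  have lpos : 0 < l := by positivity
  have hlB : l * B ≤ 1 := (le_div_iff₀ Bpos).1 (min_le_left _ _)
  have hlB2 : l * B ^ 2 ≤ d := (le_div_iff₀ (by positivity)).1 (min_le_right _ _)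
  intro T Y hT hY hYT
  have hκK : 0 ≤ |κ| * K := by positivity
  have hQd : 0 ≤ Q / d := by positivity
  have Tpos : 0 < T := by linarith
  set z := Y / T with hz
  have hzI : z ∈ Icc (0 : ℝ) 1 := ⟨by positivity, (div_le_one Tpos).2 hYT⟩
  have hYz : Y = z * T := (div_mul_cancel₀ _ Tpos.ne').symm
  rw [hYz]
  set p := drawProb f z with hp
  have hpI : p ∈ Icc (0 : ℝ) 1 := hf.drawProb_mem hzI
  have hQT : Q / T ≤ d := by
    rw [div_le_comm₀ Tpos dpos]
    linarith
  have expand := fun j => abs_lyap_add_sub_le (κ := κ) (c := c) Tpos hzI (hH.nonneg 0 j)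
    (hH.le_colTotal 0 j) (hH.colTotal_le j) (by linarith)
  have hez : Real.exp (κ * z) ≤ E := exp_mul_le_exp_abs hzI
  have hez0 := Real.exp_pos (κ * z)
  set e := Real.exp (κ * z) with he
  have bdd : ∀ j, |lyap κ c (T + colTotal H j) (z * T + H 0 j) - lyap κ c T (z * T)| ≤ B := by
    intro j
    have := abs_lyap_add_sub_lyap_le (κ := κ) cpos.le Tpos hzI (hH.nonneg 0 j)
      (hH.le_colTotal 0 j) (hH.colTotal_le j) (by linarith)
    exact this.trans (add_le_add_right hQT _)
  by_cases hθ : θ ≤ κ * z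
  · have main : p * (lyap κ c (T + colTotal H 0) (z * T + H 0 0) - lyap κ c T (z * T)) +
        (1 - p) * (lyap κ c (T + colTotal H 1) (z * T + H 0 1) - lyap κ c T (z * T)) ≤ -d := by
      have hξ := fun j => sub_le_iff_le_add'.1 ((abs_le.1 (expand j)).2.trans hQT)
      have hdr := hκ z hzI hθ
      rw [hf.drift_eq hzI, ← hp] at hdr
      refine (mean_step_le hpI hez0.le cpos.le c0.le c1.le (min_le_left _ _) (min_le_right _ _)
        (hξ 0) (hξ 1) hdr).trans_eq ?_
      rw [hd]
      ring
    have := weighted_exp_le hpI.1 (sub_nonneg.2 hpI.2) (by ring) lpos.le hlB hlB2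
      (bdd 0) (bdd 1) main
    exact this.trans (le_add_of_nonneg_right (Real.exp_pos _).le)
  -- The choice `c = e ^ θ` makes the Lyapunov function nonpositive here, so one step of size at
  -- most `B` leaves it below `B`.
  · have hneg : lyap κ c T (z * T) ≤ 0 := by
      rw [lyap, ← hYz]
      refine mul_nonpos_of_nonneg_of_nonpos Tpos.le (sub_nonpos.2 (Real.exp_le_exp.2 ?_))
      exact (not_le.1 hθ).le
    have hle : ∀ j, Real.exp (l * lyap κ c (T + colTotal H j) (z * T + H 0 j)) ≤
        Real.exp (l * B) := by
      intro j
      refine Real.exp_le_exp.2 (mul_le_mul_of_nonneg_left ?_ lpos.le)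
      exact (sub_le_iff_le_add.1 (abs_le.1 (bdd j)).2).trans (add_le_of_nonpos_right hneg)
    have u0 := mul_le_mul_of_nonneg_left (hle 0) hpI.1
    have u1 := mul_le_mul_of_nonneg_left (hle 1) (sub_nonneg.2 hpI.2)
    refine (add_le_add u0 u1).trans (le_of_eq_of_le ?_ (le_add_of_nonneg_left (Real.exp_pos _).le))
    ring

end Lyapunov

/-! ### Pathwise bounds and measurability for the urn -/

section Urn

variable {Ω : Type*} {f : ℝ → ℝ} {H : Matrix (Fin 2) (Fin 2) ℝ} {y₀ : Fin 2 → ℕ}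
  {X : ℕ → Ω → Fin 2}

lemma total_zero (ω : Ω) : total H y₀ X 0 ω = ∑ i, (y₀ i : ℝ) := rfl

lemma composition_succ (n : ℕ) (i : Fin 2) (ω : Ω) :
    composition H y₀ X (n + 1) ω i = composition H y₀ X n ω i + H i (X (n + 1) ω) := rfl

lemma total_succ (n : ℕ) (ω : Ω) :
    total H y₀ X (n + 1) ω = total H y₀ X n ω + colTotal H (X (n + 1) ω) := by
  simp [total, composition_succ, colTotal]
  ring

lemma composition_nonneg (hH : IsUnbalancedReplacement H) (n : ℕ) (i : Fin 2) (ω : Ω) :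
    0 ≤ composition H y₀ X n ω i := by
  induction n with
  | zero => exact Nat.cast_nonneg _
  | succ n ih => exact add_nonneg ih (hH.nonneg _ _)

lemma composition_le_total (hH : IsUnbalancedReplacement H) (n : ℕ) (i : Fin 2) (ω : Ω) :
    composition H y₀ X n ω i ≤ total H y₀ X n ω :=
  Finset.single_le_sum (f := fun i => composition H y₀ X n ω i)
    (fun i _ => composition_nonneg hH n i ω) (Finset.mem_univ i)

lemma min_colTotal_le (j : Fin 2) : min (colTotal H 0) (colTotal H 1) ≤ colTotal H j := by
  fin_cases j <;> simp

lemma mul_le_total (n : ℕ) (ω : Ω) :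
    (n : ℝ) * min (colTotal H 0) (colTotal H 1) ≤ total H y₀ X n ω := by
  induction n with
  | zero =>
    rw [total_zero, Nat.cast_zero, zero_mul]
    positivity
  | succ n ih =>
    rw [total_succ]
    push_cast
    linarith [min_colTotal_le (H := H) (X (n + 1) ω)]

lemma total_pos (hH : IsUnbalancedReplacement H) (hy₀ : y₀ ≠ 0) (n : ℕ) (ω : Ω) :
    0 < total H y₀ X n ω := by
  induction n with
  | zero =>
    rw [total_zero]
    obtain ⟨i, hi⟩ := Function.ne_iff.1 hy₀
    refine Finset.sum_pos' (fun i _ => Nat.cast_nonneg _) ⟨i, Finset.mem_univ i, ?_⟩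
    exact_mod_cast Nat.pos_of_ne_zero hi
  | succ n ih =>
    rw [total_succ]
    linarith [hH.colTotal_pos (X (n + 1) ω)]

lemma total_le (hH : IsUnbalancedReplacement H) (n : ℕ) (ω : Ω) :
    total H y₀ X n ω ≤ ∑ i, (y₀ i : ℝ) + n * (colTotal H 0 + colTotal H 1) := by
  induction n with
  | zero => rw [total_zero, Nat.cast_zero, zero_mul, add_zero]
  | succ n ih =>
    rw [total_succ]
    push_cast
    linarith [hH.colTotal_le (X (n + 1) ω)]

lemma proportion_mem (hH : IsUnbalancedReplacement H) (hy₀ : y₀ ≠ 0) (n : ℕ) (i : Fin 2) (ω : Ω) :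
    proportion H y₀ X i n ω ∈ Icc (0 : ℝ) 1 :=
  ⟨div_nonneg (composition_nonneg hH n i ω) (total_pos hH hy₀ n ω).le,
    (div_le_one (total_pos hH hy₀ n ω)).2 (composition_le_total hH n i ω)⟩

lemma proportion_one (hH : IsUnbalancedReplacement H) (hy₀ : y₀ ≠ 0) (n : ℕ) (ω : Ω) :
    proportion H y₀ X 1 n ω = 1 - proportion H y₀ X 0 n ω := by
  rw [proportion, proportion, one_sub_div (total_pos hH hy₀ n ω).ne', total, Fin.sum_univ_two,
    add_sub_cancel_left]

lemma drawSigma_mono : Monotone (drawSigma X) := fun _ _ hmn =>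
  biSup_mono fun _ hk => ⟨hk.1, hk.2.trans hmn⟩

lemma measurable_draw {n : ℕ} (hn : 1 ≤ n) : Measurable[drawSigma X n] (X n) := by
  rw [measurable_iff_comap_le]
  exact le_iSup₂_of_le (f := fun k (_ : k ∈ Icc 1 n) => MeasurableSpace.comap (X k) ⊤) n ⟨hn, le_rfl⟩
    le_rfl

lemma measurable_composition (n : ℕ) (i : Fin 2) :
    Measurable[drawSigma X n] fun ω => composition H y₀ X n ω i := by
  induction n with
  | zero => exact measurable_const
  | succ n ih =>
    have h1 : Measurable[drawSigma X (n + 1)] fun ω => composition H y₀ X n ω i :=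
      ih.mono (drawSigma_mono n.le_succ) le_rfl
    have h2 : Measurable[drawSigma X (n + 1)] fun ω => H i (X (n + 1) ω) :=
      (Measurable.of_discrete (f := fun j => H i j)).comp (measurable_draw (Nat.le_add_left 1 n))
    exact h1.add h2

lemma measurable_total (n : ℕ) : Measurable[drawSigma X n] (total H y₀ X n) :=
  Finset.measurable_sum _ fun i _ => measurable_composition n i

lemma measurable_exp_lyap {m : MeasurableSpace Ω} {T Y : Ω → ℝ} (hT : Measurable T)
    (hY : Measurable Y) (l κ c : ℝ) : Measurable fun ω => Real.exp (l * lyap κ c (T ω) (Y ω)) := by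
  unfold lyap
  fun_prop

lemma norm_exp_lyap_le {l κ c T Y R : ℝ} (hl : 0 ≤ l) (hc : 0 ≤ c) (hT : 0 < T) (hY : 0 ≤ Y)
    (hYT : Y ≤ T) (hR : T ≤ R) :
    ‖Real.exp (l * lyap κ c T Y)‖ ≤ Real.exp (l * (R * Real.exp |κ|)) := by
  rw [Real.norm_of_nonneg (Real.exp_pos _).le]
  exact Real.exp_le_exp.2 (mul_le_mul_of_nonneg_left (lyap_le hc hT hY hYT hR) hl)

/-! ### Conditioning on the past, and the exponential tail -/

variable [MeasurableSpace Ω] {P : Measure Ω}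

lemma IsUrnDraws.drawSigma_le (hX : IsUrnDraws P f H y₀ X) (n : ℕ) :
    drawSigma X n ≤ ‹MeasurableSpace Ω› :=
  iSup₂_le fun k hk => measurable_iff_comap_le.1 (hX.measurable k hk.1)

variable [IsProbabilityMeasure P]

/-- Averaging a bounded function of the past over the next draw. -/
lemma IsUrnDraws.integral_mul_indicator (hX : IsUrnDraws P f H y₀ X) {n : ℕ} (j : Fin 2)
    {G : Ω → ℝ} (hG : Measurable[drawSigma X n] G) {R : ℝ} (hR : ∀ ω, ‖G ω‖ ≤ R) :
    ∫ ω, G ω * {ω | X (n + 1) ω = j}.indicator (fun _ => (1 : ℝ)) ω ∂P =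
      ∫ ω, G ω * (f (proportion H y₀ X j n ω) /
        (f (proportion H y₀ X 0 n ω) + f (proportion H y₀ X 1 n ω))) ∂P := by
  have hm := hX.drawSigma_le n
  have hs : MeasurableSet {ω | X (n + 1) ω = j} :=
    hX.measurable (n + 1) (Nat.le_add_left 1 n) (measurableSet_singleton j)
  have hi : Integrable ({ω | X (n + 1) ω = j}.indicator fun _ => (1 : ℝ)) P :=
    (integrable_const _).indicator hs
  have h1 := condExp_stronglyMeasurable_mul_of_bound hm hG.stronglyMeasurable hi R
    (Eventually.of_forall hR)
  calc _ = ∫ ω, (P[G * {ω | X (n + 1) ω = j}.indicator (fun _ => (1 : ℝ)) | drawSigma X n]) ω ∂P :=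
        (integral_condExp hm).symm
    _ = _ := by
        refine integral_congr_ae ?_
        filter_upwards [h1, hX.condProb n j] with ω hω1 hω2
        rw [hω1, Pi.mul_apply, hω2]

lemma IsUrnDraws.integrable_exp_lyap (hX : IsUrnDraws P f H y₀ X)
    (hH : IsUnbalancedReplacement H) (hy₀ : y₀ ≠ 0) {l κ c : ℝ} (hl : 0 ≤ l) (hc : 0 ≤ c) (n : ℕ) :
    Integrable (fun ω => Real.exp (l * lyap κ c (total H y₀ X n ω) (composition H y₀ X n ω 0))) P :=
  Integrable.of_bound ((measurable_exp_lyap (measurable_total n) (measurable_composition n 0)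
    l κ c).mono (hX.drawSigma_le n) le_rfl).aestronglyMeasurable _
    (Eventually.of_forall fun ω => norm_exp_lyap_le hl hc (total_pos hH hy₀ n ω)
      (composition_nonneg hH n 0 ω) (composition_le_total hH n 0 ω) (total_le hH n ω))

lemma IsUrnDraws.integral_exp_lyap_succ_le (hX : IsUrnDraws P f H y₀ X) (hf : IsSkewing f)
    (hH : IsUnbalancedReplacement H) (hy₀ : y₀ ≠ 0) {l κ c C : ℝ} (hl : 0 ≤ l) (hc : 0 ≤ c) {n : ℕ}
    (hstep : ∀ ω, ∀ T Y : ℝ, T = total H y₀ X n ω → Y = composition H y₀ X n ω 0 →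
      drawProb f (Y / T) * Real.exp (l * lyap κ c (T + colTotal H 0) (Y + H 0 0)) +
      (1 - drawProb f (Y / T)) * Real.exp (l * lyap κ c (T + colTotal H 1) (Y + H 0 1)) ≤
      Real.exp (l * lyap κ c T Y) + C) :
    ∫ ω, Real.exp (l * lyap κ c (total H y₀ X (n + 1) ω) (composition H y₀ X (n + 1) ω 0)) ∂P ≤
      ∫ ω, Real.exp (l * lyap κ c (total H y₀ X n ω) (composition H y₀ X n ω 0)) ∂P + C := by
  -- `G j` is the next value if the draw is `j`; it depends on the past only, so the draw can be
  -- averaged out.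
  set G : Fin 2 → Ω → ℝ := fun j ω => Real.exp (l * lyap κ c (total H y₀ X n ω + colTotal H j)
    (composition H y₀ X n ω 0 + H 0 j)) with hG
  set R := Real.exp (l * ((∑ i, (y₀ i : ℝ) + (n + 1 : ℕ) * (colTotal H 0 + colTotal H 1)) *
    Real.exp |κ|)) with hR
  have hGm : ∀ j, Measurable[drawSigma X n] (G j) := fun j =>
    measurable_exp_lyap ((measurable_total n).add_const _) ((measurable_composition n 0).add_const _)
      l κ c
  have hGR : ∀ j ω, ‖G j ω‖ ≤ R := by
    intro j ω
    refine norm_exp_lyap_le hl hc (add_pos (total_pos hH hy₀ n ω) (hH.colTotal_pos j))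
      (add_nonneg (composition_nonneg hH n 0 ω) (hH.nonneg 0 j))
      (add_le_add (composition_le_total hH n 0 ω) (hH.le_colTotal 0 j)) ?_
    push_cast
    linarith [hH.colTotal_le j, total_le (y₀ := y₀) (X := X) hH n ω]
  have hGi : ∀ j, Integrable (G j) P := fun j =>
    Integrable.of_bound ((hGm j).mono (hX.drawSigma_le n) le_rfl).aestronglyMeasurable R
      (Eventually.of_forall (hGR j))
  have hs : ∀ j, MeasurableSet {ω | X (n + 1) ω = j} := fun j =>
    hX.measurable (n + 1) (Nat.le_add_left 1 n) (measurableSet_singleton j)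
  have hGs : ∀ j, Integrable
      (fun ω => G j ω * {ω | X (n + 1) ω = j}.indicator (fun _ => (1 : ℝ)) ω) P := by
    intro j
    refine ((hGi j).indicator (hs j)).congr (Eventually.of_forall fun ω => ?_)
    by_cases h : X (n + 1) ω = j <;> simp [h]
  have hprob : ∀ ω, f (proportion H y₀ X 0 n ω) /
      (f (proportion H y₀ X 0 n ω) + f (proportion H y₀ X 1 n ω)) =
      drawProb f (proportion H y₀ X 0 n ω) := by
    intro ω
    rw [drawProb, proportion_one hH hy₀]
  have hprob' : ∀ ω, f (proportion H y₀ X 1 n ω) /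
      (f (proportion H y₀ X 0 n ω) + f (proportion H y₀ X 1 n ω)) =
      1 - drawProb f (proportion H y₀ X 0 n ω) := by
    intro ω
    rw [hf.one_sub_drawProb (proportion_mem hH hy₀ n 0 ω), proportion_one hH hy₀]
  have hsplit : ∀ ω, Real.exp (l * lyap κ c (total H y₀ X (n + 1) ω)
      (composition H y₀ X (n + 1) ω 0)) =
      G 0 ω * {ω | X (n + 1) ω = 0}.indicator (fun _ => (1 : ℝ)) ω +
      G 1 ω * {ω | X (n + 1) ω = 1}.indicator (fun _ => (1 : ℝ)) ω := by
    intro ω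
    rw [total_succ, composition_succ]
    obtain h | h : X (n + 1) ω = 0 ∨ X (n + 1) ω = 1 := by
      generalize X (n + 1) ω = k
      fin_cases k <;> simp
    all_goals simp [hG, h]
  -- `f` is controlled only on `[0,1]`; integrability is inherited from the conditional expectation
  -- that this product equals almost everywhere.
  have hmul : ∀ j, Integrable (fun ω => G j ω * (f (proportion H y₀ X j n ω) /
      (f (proportion H y₀ X 0 n ω) + f (proportion H y₀ X 1 n ω)))) P := by
    intro j
    have h1 := condExp_stronglyMeasurable_mul_of_bound (μ := P) (hX.drawSigma_le n)
      (hGm j).stronglyMeasurable ((integrable_const (1 : ℝ)).indicator (hs j)) R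
      (Eventually.of_forall (hGR j))
    refine (integrable_condExp (μ := P) (m := drawSigma X n)).congr (h1.trans ?_)
    filter_upwards [hX.condProb n j] with ω hω
    rw [Pi.mul_apply, hω]
  have hi := hX.integrable_exp_lyap hH hy₀ (l := l) (κ := κ) (c := c) hl hc n
  calc _ = ∫ ω, G 0 ω * {ω | X (n + 1) ω = 0}.indicator (fun _ => (1 : ℝ)) ω ∂P +
        ∫ ω, G 1 ω * {ω | X (n + 1) ω = 1}.indicator (fun _ => (1 : ℝ)) ω ∂P := by
        rw [← integral_add (hGs 0) (hGs 1)]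
        exact integral_congr_ae (Eventually.of_forall hsplit)
    _ ≤ ∫ ω, (Real.exp (l * lyap κ c (total H y₀ X n ω) (composition H y₀ X n ω 0)) + C) ∂P := by
        rw [hX.integral_mul_indicator 0 (hGm 0) (hGR 0),
          hX.integral_mul_indicator 1 (hGm 1) (hGR 1), ← integral_add (hmul 0) (hmul 1)]
        refine integral_mono ((hmul 0).add (hmul 1)) (hi.add (integrable_const C)) fun ω => ?_
        have := hstep ω _ _ rfl rfl
        simp only [hprob, hprob']
        rw [mul_comm (G 0 ω), mul_comm (G 1 ω)]
        exact this
    _ = _ := by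
        rw [integral_add hi (integrable_const C)]
        simp

/-- Exponential decay of the probability that `κ Z` exceeds `θ` by a fixed amount, when
`κ • drift` dominates the growth of the urn on `{z | θ ≤ κ z}`. -/
lemma IsUrnDraws.exists_exp_tail (hX : IsUrnDraws P f H y₀ X) (hf : IsSkewing f)
    (hH : IsUnbalancedReplacement H) (hy₀ : y₀ ≠ 0) {κ θ η : ℝ} (hη : 0 < η)
    (hκ : ∀ z ∈ Icc (0 : ℝ) 1, θ ≤ κ * z →
      colTotal H 0 + colTotal H 1 + κ * drift f H z ≤ 0) :
    ∃ a : ℝ, 0 < a ∧ ∀ᶠ n : ℕ in atTop,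
      P.real {ω | θ + η ≤ κ * proportion H y₀ X 0 n ω} ≤ Real.exp (-a * n) := by
  obtain ⟨l, C, T₀, hl, hC, hstep⟩ := exists_exp_lyap_step hf hH hκ
  set μ := min (colTotal H 0) (colTotal H 1) with hμ
  have μpos : 0 < μ := lt_min (hH.colTotal_pos 0) (hH.colTotal_pos 1)
  set M : ℕ → ℝ := fun n => ∫ ω, Real.exp (l * lyap κ (Real.exp θ) (total H y₀ X n ω)
    (composition H y₀ X n ω 0)) ∂P with hM
  -- From time `N` on, `T₀ ≤ n * μ ≤ total`, so the one-step bound applies on every path.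
  obtain ⟨N, hN⟩ := exists_nat_ge (T₀ / μ)
  have hrec : ∀ n, N ≤ n → M (n + 1) ≤ M n + C := by
    intro n hn
    refine hX.integral_exp_lyap_succ_le hf hH hy₀ hl.le (Real.exp_pos θ).le fun ω T Y hT hY => ?_
    subst hT hY
    refine hstep _ _ ?_ (composition_nonneg hH n 0 ω) (composition_le_total hH n 0 ω)
    refine le_trans ?_ (mul_le_total n ω)
    rw [← div_le_iff₀ μpos]
    exact hN.trans (by exact_mod_cast hn)
  have hgrow : ∀ n, N ≤ n → M n ≤ M N + n * C := by
    intro n hn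
    induction n, hn using Nat.le_induction with
    | base => exact le_add_of_nonneg_right (by positivity)
    | succ n hn ih =>
      have := hrec n hn
      push_cast
      linarith
  set b := l * (μ * (Real.exp (θ + η) - Real.exp θ)) with hb
  have bpos : 0 < b :=
    mul_pos hl (mul_pos μpos (sub_pos.2 (Real.exp_lt_exp.2 (by linarith))))
  have hmarkov : ∀ n : ℕ, Real.exp (b * n) *
      P.real {ω | θ + η ≤ κ * proportion H y₀ X 0 n ω} ≤ M n := by
    intro n
    refine le_trans ?_ (mul_meas_ge_le_integral_of_nonneg
      (Eventually.of_forall fun ω => (Real.exp_pos _).le)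
      (hX.integrable_exp_lyap hH hy₀ (κ := κ) hl.le (Real.exp_pos θ).le n) (Real.exp (b * n)))
    refine mul_le_mul_of_nonneg_left (measureReal_mono fun ω hω => ?_) (Real.exp_pos _).le
    have hω' : θ + η ≤ κ * (composition H y₀ X n ω 0 / total H y₀ X n ω) := hω
    refine Real.exp_le_exp.2 ?_
    have h1 : (n : ℝ) * μ ≤ total H y₀ X n ω := mul_le_total n ω
    have h2 := Real.exp_le_exp.2 hω'
    have h3 : 0 ≤ Real.exp (θ + η) - Real.exp θ :=
      sub_nonneg.2 (Real.exp_le_exp.2 (by linarith))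
    calc b * n = l * ((n * μ) * (Real.exp (θ + η) - Real.exp θ)) := by rw [hb]; ring
      _ ≤ l * lyap κ (Real.exp θ) (total H y₀ X n ω) (composition H y₀ X n ω 0) := by
          unfold lyap
          have := (total_pos (X := X) hH hy₀ n ω).le
          gcongr
  -- Markov's inequality gives rate `b` with a linear prefactor; half of the rate absorbs the
  -- prefactor.
  refine ⟨b / 2, by positivity, ?_⟩
  have hlim : Tendsto (fun n : ℕ => (M N + n * C) * Real.exp (-(b / 2) * n)) atTop (nhds 0) := by
    have hb2 : 0 < b / 2 := by positivity
    have h0 : Tendsto (fun x : ℝ => Real.exp (-(b / 2) * x)) atTop (nhds 0) := by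
      simpa using tendsto_rpow_mul_exp_neg_mul_atTop_nhds_zero 0 (b / 2) hb2
    have h1 : Tendsto (fun x : ℝ => x * Real.exp (-(b / 2) * x)) atTop (nhds 0) := by
      simpa using tendsto_rpow_mul_exp_neg_mul_atTop_nhds_zero 1 (b / 2) hb2
    have h2 := (h0.const_mul (M N)).add (h1.const_mul C)
    simp only [mul_zero, add_zero] at h2
    refine (h2.comp tendsto_natCast_atTop_atTop).congr fun n => ?_
    simp only [Function.comp_apply]
    ring
  filter_upwards [hlim.eventually_le_const zero_lt_one, eventually_ge_atTop N] with n hn hnN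
  have h1 := (hmarkov n).trans (hgrow n hnN)
  have h2 : Real.exp (b * n) * Real.exp (-(b / 2) * n) * Real.exp (-(b / 2) * n) = 1 := by
    rw [← Real.exp_add, ← Real.exp_add, Real.exp_eq_one_iff]
    ring
  have hp := Real.exp_pos (-(b / 2) * n)
  set q := P.real {ω | θ + η ≤ κ * proportion H y₀ X 0 n ω}
  set e := Real.exp (-(b / 2) * n)
  calc q = Real.exp (b * n) * q * e * e := by linear_combination (-q) * h2
    _ ≤ (M N + n * C) * e * e := by gcongr
    _ ≤ 1 * e := by gcongr
    _ = e := one_mul e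

end Urn

/-! ### The two tails combined -/

theorem theorem2p1 {Ω : Type*} [MeasurableSpace Ω] (P : Measure Ω) [IsProbabilityMeasure P]
    (f : ℝ → ℝ) (hf : IsSkewing f)
    (H : Matrix (Fin 2) (Fin 2) ℝ) (hH : IsUnbalancedReplacement H)
    (y₀ : Fin 2 → ℕ) (hy₀ : y₀ ≠ 0)
    (X : ℕ → Ω → Fin 2) (hX : IsUrnDraws P f H y₀ X)
    (hconc : H 0 0 / colTotal H 0 > H 0 1 / colTotal H 1 → ConcaveOn ℝ (Set.Icc 0 1) f)
    (hmono : AntitoneOn (drift f H) (Set.Icc 0 1)) :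
    ∃ ystar : ℝ,
      (ystar ∈ Set.Icc (0 : ℝ) 1 ∧ drift f H ystar = 0 ∧
        ∀ y ∈ Set.Icc (0 : ℝ) 1, drift f H y = 0 → y = ystar) ∧
      ∀ ε : ℝ, 0 < ε → ∃ a : ℝ, 0 < a ∧ ∀ᶠ n : ℕ in Filter.atTop,
        P.real {ω | ε < |proportion H y₀ X 0 (n + 1) ω - ystar|} ≤
          2 * Real.exp (-a * (n : ℝ)) := by
  obtain ⟨ystar, hy, hy0⟩ := exists_drift_eq_zero hf hH
  have huniq : ∀ y ∈ Set.Icc (0 : ℝ) 1, drift f H y = 0 → y = ystar := fun y hy' hy0' =>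
    le_antisymm (not_lt.1 (not_lt_of_drift_eq_zero hf hH hconc hy hy' hy0 hy0'))
      (not_lt.1 (not_lt_of_drift_eq_zero hf hH hconc hy' hy hy0' hy0))
  refine ⟨ystar, ⟨hy, hy0, huniq⟩, fun ε hε => ?_⟩
  set K := colTotal H 0 + colTotal H 1 with hK
  have Kpos : 0 < K := add_pos (hH.colTotal_pos 0) (hH.colTotal_pos 1)
  -- Half of `ε` keeps the drift away from zero; the other half is the margin `η` in the tail bound.
  -- The multiplier gives equality at `ystar + ε / 2`, and monotonicity covers larger `z`. If that
  -- point exceeds `1`, the condition is vacuous.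
  have hup : ∃ κ : ℝ, 0 < κ ∧ ∀ z ∈ Set.Icc (0 : ℝ) 1, κ * (ystar + ε / 2) ≤ κ * z →
      K + κ * drift f H z ≤ 0 := by
    by_cases h1 : ystar + ε / 2 ≤ 1
    · have hm : ystar + ε / 2 ∈ Set.Icc (0 : ℝ) 1 := ⟨by linarith [hy.1], h1⟩
      have hneg : drift f H (ystar + ε / 2) < 0 := by
        refine lt_of_le_of_ne (hy0 ▸ hmono hy hm (by linarith)) fun h => ?_
        linarith [huniq _ hm h]
      have hκ : 0 < K / -drift f H (ystar + ε / 2) := div_pos Kpos (by linarith)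
      refine ⟨_, hκ, fun z hz hz' => ?_⟩
      have := mul_le_mul_of_nonneg_left (hmono hm hz (le_of_mul_le_mul_left hz' hκ)) hκ.le
      have e : K / -drift f H (ystar + ε / 2) * drift f H (ystar + ε / 2) = -K := by
        rw [div_neg, neg_mul, div_mul_cancel₀ _ hneg.ne]
      linarith
    · refine ⟨1, one_pos, fun z hz hz' => ?_⟩
      linarith [hz.2]
  have hdown : ∃ κ : ℝ, 0 < κ ∧ ∀ z ∈ Set.Icc (0 : ℝ) 1, -κ * (ystar - ε / 2) ≤ -κ * z →
      K + -κ * drift f H z ≤ 0 := by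
    by_cases h1 : 0 ≤ ystar - ε / 2
    · have hm : ystar - ε / 2 ∈ Set.Icc (0 : ℝ) 1 := ⟨h1, by linarith [hy.2]⟩
      have hpos : 0 < drift f H (ystar - ε / 2) := by
        refine lt_of_le_of_ne (hy0 ▸ hmono hm hy (by linarith)) fun h => ?_
        linarith [huniq _ hm h.symm]
      have hκ : 0 < K / drift f H (ystar - ε / 2) := div_pos Kpos hpos
      refine ⟨_, hκ, fun z hz hz' => ?_⟩
      have hz2 : z ≤ ystar - ε / 2 := by
        refine le_of_mul_le_mul_left ?_ hκ
        linarith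
      have := mul_le_mul_of_nonneg_left (hmono hz hm hz2) hκ.le
      have e : K / drift f H (ystar - ε / 2) * drift f H (ystar - ε / 2) = K :=
        div_mul_cancel₀ _ hpos.ne'
      linarith
    · refine ⟨1, one_pos, fun z hz hz' => ?_⟩
      linarith [hz.1]
  obtain ⟨κ, hκ, hup⟩ := hup
  obtain ⟨κ', hκ', hdown⟩ := hdown
  obtain ⟨a, ha, hA⟩ := hX.exists_exp_tail hf hH hy₀ (by positivity : 0 < κ * (ε / 2)) hup
  obtain ⟨b, hb, hB⟩ := hX.exists_exp_tail hf hH hy₀ (by positivity : 0 < κ' * (ε / 2)) hdown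
  refine ⟨min a b, lt_min ha hb, ?_⟩
  filter_upwards [(Filter.tendsto_add_atTop_nat 1).eventually hA,
    (Filter.tendsto_add_atTop_nat 1).eventually hB] with n hn1 hn2
  -- The tail bounds are used at time `n + 1`; the extra factor `exp (-c)` is at most one.
  have hdecay : ∀ c, min a b ≤ c → 0 < c →
      Real.exp (-c * ((n + 1 : ℕ) : ℝ)) ≤ Real.exp (-(min a b) * n) := by
    intro c hc hc0
    refine Real.exp_le_exp.2 ?_
    push_cast
    linarith [mul_le_mul_of_nonneg_right hc (Nat.cast_nonneg (α := ℝ) n)]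
  have hsub : {ω | ε < |proportion H y₀ X 0 (n + 1) ω - ystar|} ⊆
      {ω | κ * (ystar + ε / 2) + κ * (ε / 2) ≤ κ * proportion H y₀ X 0 (n + 1) ω} ∪
      {ω | -κ' * (ystar - ε / 2) + κ' * (ε / 2) ≤ -κ' * proportion H y₀ X 0 (n + 1) ω} := by
    intro ω hω
    rcases lt_abs.1 (show ε < |proportion H y₀ X 0 (n + 1) ω - ystar| from hω) with h | h
    · left
      have := mul_lt_mul_of_pos_left h hκ
      simp only [Set.mem_ofPred_eq]
      linarith
    · right
      have := mul_lt_mul_of_pos_left h hκ'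
      simp only [Set.mem_ofPred_eq]
      linarith
  calc _ ≤ _ := MeasureTheory.measureReal_mono hsub
    _ ≤ _ := MeasureTheory.measureReal_union_le _ _
    _ ≤ Real.exp (-(min a b) * n) + Real.exp (-(min a b) * n) :=
        add_le_add (hn1.trans (hdecay a (min_le_left _ _) ha))
          (hn2.trans (hdecay b (min_le_right _ _) hb))
    _ = 2 * Real.exp (-(min a b) * n) := by ring
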